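/- \textbf{Definitions.} For $\sigma^2\ge 0$, $b\in\mathbb{R}$ and a L\'evy measure $\Pi$ on $\mathbb{R}$ (that is, $\Pi(\{0\})=0$ and $\int_{\mathbb R} (1\wedge x^2)\,\Pi(dx)<\infty$), let $ID(\sigma^2,b,\Pi)$ denote the infinitely divisible probability law on $\mathbb{R}$ with characteristic function $e^{\Psi(\theta)}$, where $$\Psi(\theta)=-\tfrac12\theta^2\sigma^2+i\theta b+\int_{\mathbb{R}}\Big(e^{i\theta x}-1-\frac{i\theta x}{1+x^2}\Big)\Pi(dx),\qquad \theta\in\mathbb{R}.$$ A \emph{L\'evy--Khintchine random matrix ensemble} with characteristics $(\sigma^2,0,\Pi)$ is a sequence $(\mathcal{C}_n)_{n\ge1}$ of random complex $n\times n$ matrices such that for each $n$ the matrix $\mathcal{C}_n$ is Hermitian with zero diagonal, the moduli $|\mathcal{C}_n(j,k)|$, $j<k$, are i.i.d., and, as $n\to\infty$, the sums $\sum_{k=1}^n \pm|\mathcal{C}_n(1,k)|$ converge in distribution to $ID(\sigma^2,0,\Pi)$, where the signs $\pm$ are independent Rademacher variables that are also independent of $\mathcal{C}_n$. For $\tau>0$,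 the truncation $\tau\mathcal{C}_n$ is the matrix with entries $\tau\mathcal{C}_n(j,k)=\mathcal{C}_n(j,k)\mathbf{1}_{\{|\mathcal{C}_n(j,k)|\le\tau\}}$. \textbf{Lemma (Large deviation estimate for the rank of a truncation).} Let $(\mathcal{C}_n)_{n\ge1}$ be a L\'evy--Khintchine random matrix ensemble with characteristics $(\sigma^2,0,\Pi)$. For every $\epsilon>0$ there is $\tau_0>0$ such that for every $\tau\ge\tau_0$ there is $\delta=\delta_{\epsilon,\tau}>0$ such that for all $n\ge1$, $$\mathbf{P}\left(\frac{\operatorname{rank}(\mathcal{C}_n-\tau\mathcal{C}_n)}{n}\ge\epsilon\right)\le e^{-\delta n}.$$ -/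

import Mathlib

open MeasureTheory ProbabilityTheory Filter Topology
open scoped ENNReal

noncomputable section

/-- The Rademacher law `(δ₁ + δ₋₁) / 2` on the real line. -/
def rademacher : Measure ℝ :=
  (2⁻¹ : ℝ≥0∞) • Measure.dirac 1 + (2⁻¹ : ℝ≥0∞) • Measure.dirac (-1)

instance rademacher.instIsProbabilityMeasure : IsProbabilityMeasure rademacher :=
  ⟨by simp [rademacher, ENNReal.inv_two_add_inv_two]⟩

/-- Lévy measures on `ℝ`: no mass at `0`, and `1 ∧ x²` has a finite integral. -/
structure IsLevyMeasure (Pi : Measure ℝ) : Prop where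
  zero : Pi {0} = 0
  lintegral_lt_top : ∫⁻ x, ENNReal.ofReal (min 1 (x ^ 2)) ∂Pi < ∞

/-- The Lévy exponent
`Ψ(θ) = - θ² σ² / 2 + i θ b + ∫ (e^{iθx} - 1 - iθx / (1 + x²)) Π(dx)`;
the argument `sigmaSq` is the Gaussian variance `σ²`. -/
def levyExponent (sigmaSq b : ℝ) (Pi : Measure ℝ) (θ : ℝ) : ℂ :=
  -((θ ^ 2 * sigmaSq / 2 : ℝ) : ℂ) + Complex.I * θ * b +
    ∫ x : ℝ, (Complex.exp (Complex.I * θ * x) - 1 - Complex.I * θ * x / (1 + (x : ℂ) ^ 2)) ∂Pi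

/-- `μ` is the infinitely divisible probability law `ID(σ², b, Π)` with characteristics
`(σ², b, Π)`. -/
structure IsInfinitelyDivisibleWith (μ : Measure ℝ) (sigmaSq b : ℝ) (Pi : Measure ℝ) : Prop where
  isProbabilityMeasure : IsProbabilityMeasure μ
  sigmaSq_nonneg : 0 ≤ sigmaSq
  isLevyMeasure : IsLevyMeasure Pi
  charFun_eq : ∀ θ : ℝ, charFun μ θ = Complex.exp (levyExponent sigmaSq b Pi θ)

/-- The randomly signed sum `∑ₖ ± |A(j, k)|` of the moduli in row `j`, as a random variable on the
product of the probability space with a space of signs. -/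
def signedRowSum {Ω : Type*} {n : ℕ} (A : Ω → Matrix (Fin n) (Fin n) ℂ) (j : Fin n)
    (p : Ω × (Fin n → ℝ)) : ℝ :=
  ∑ k, p.2 k * ‖A p.1 j k‖

/-- `C` is a Lévy–Khintchine random matrix ensemble with characteristics `(σ², 0, Π)`: for each `n`
the `n × n` matrix `C n` is Hermitian with zero diagonal, the moduli of its off-diagonal entries
are i.i.d. up to the Hermitian symmetry, and the sums `∑ₖ ± |C n (1, k)|` over the first row, with
independent Rademacher signs that are also independent of `C n`, converge in distribution to
`ID(σ², 0, Π)`. The limit is taken along the matrices of size `n + 1`, whose first row has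
index `0`. -/
structure IsLevyKhintchineEnsemble {Ω : Type*} [MeasurableSpace Ω] (P : Measure Ω)
    [IsProbabilityMeasure P] (C : (n : ℕ) → Ω → Matrix (Fin n) (Fin n) ℂ)
    (sigmaSq : ℝ) (Pi : Measure ℝ) : Prop where
  measurable : ∀ n j k, Measurable fun ω => C n ω j k
  isHermitian : ∀ n ω, (C n ω).IsHermitian
  diag_eq_zero : ∀ n ω j, C n ω j j = 0
  indep : ∀ n, iIndepFun
    (fun (p : {p : Fin n × Fin n // p.1 < p.2}) ω => ‖C n ω p.1.1 p.1.2‖) P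
  identDistrib : ∀ n (j k j' k' : Fin n), j ≠ k → j' ≠ k' →
    IdentDistrib (fun ω => ‖C n ω j k‖) (fun ω => ‖C n ω j' k'‖) P P
  limit : ∃ (μ : Measure ℝ) (_ : IsProbabilityMeasure μ),
    IsInfinitelyDivisibleWith μ sigmaSq 0 Pi ∧
    TendstoInDistribution (fun n : ℕ => signedRowSum (C (n + 1)) 0) atTop (id : ℝ → ℝ)
      (fun n : ℕ => P.prod (Measure.pi fun _ : Fin (n + 1) => rademacher)) μ

/-- The truncation `τA` of a matrix: entries of modulus larger than `τ` are replaced by `0`. -/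
def truncateEntries {n : ℕ} (τ : ℝ) (A : Matrix (Fin n) (Fin n) ℂ) : Matrix (Fin n) (Fin n) ℂ :=
  Matrix.of fun j k => if ‖A j k‖ ≤ τ then A j k else 0

end

/-! The rank is at most the number of nonzero rows, hence at most twice the number of large entries
above the diagonal. Those exceedances are independent, and there are fewer than `n ^ 2` candidates.
If each has probability at most `η / n`, their expected number is at most `η n`, and a Chernoff
bound makes a count of order `ε n` exponentially unlikely once `η` is a small multiple of `ε`.

The bound `η / n` comes from the limit law. Convergence in distribution makes the signed row sums
uniformly tight for large `n`. Flipping one sign shows that a large entry makes the sum large with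
probability at least one half, so a row rarely contains a large entry. By independence, the expected
number of large entries in a row is then small. -/

/-- The rank of a matrix is at most the number of its rows that do not vanish. -/
theorem Matrix.rank_le_card_of_row_eq_zero {m n K : Type*} [Fintype m] [Fintype n] [Field K]
    (A : Matrix m n K) (s : Finset m) (hs : ∀ i, i ∉ s → A i = 0) : A.rank ≤ s.card := by
  classical
  rw [Matrix.rank_eq_finrank_span_row]
  have hle : Submodule.span K (Set.range A.row) ≤ Submodule.span K (s.image A : Set (n → K)) := by
    rw [Submodule.span_le]
    rintro _ ⟨i, rfl⟩
    by_cases hi : i ∈ s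
    · exact Submodule.subset_span (Finset.mem_coe.2 (Finset.mem_image_of_mem _ hi))
    · have h0 : A.row i = 0 := hs i hi
      rw [h0]
      exact Submodule.zero_mem _
  calc _ ≤ Module.finrank K (Submodule.span K (s.image A : Set (n → K))) :=
        Submodule.finrank_mono hle
    _ ≤ (s.image A).card := finrank_span_finset_le_card _
    _ ≤ s.card := Finset.card_image_le

/-- The rank of `A - τA` is at most twice the number of entries above the diagonal whose modulus
exceeds `τ`. -/
theorem rank_sub_truncateEntries_le {n : ℕ} {τ : ℝ} (hτ : 0 < τ) {A : Matrix (Fin n) (Fin n) ℂ}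
    (hA : A.IsHermitian) (hdiag : ∀ j, A j j = 0) :
    (A - truncateEntries τ A).rank ≤
      2 * (Finset.univ.filter fun p : {p : Fin n × Fin n // p.1 < p.2} =>
        τ < ‖A p.1.1 p.1.2‖).card := by
  classical
  set s := Finset.univ.filter fun p : {p : Fin n × Fin n // p.1 < p.2} => τ < ‖A p.1.1 p.1.2‖
    with hs
  -- A nonzero row `j` contains a large entry; the representative of that entry above the diagonal
  -- has `j` as its row or column index.
  refine (Matrix.rank_le_card_of_row_eq_zero _
    (s.image (fun p => p.1.1) ∪ s.image (fun p => p.1.2)) fun j hj => ?_).trans ?_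
  · funext k
    by_contra hne
    have hbig : τ < ‖A j k‖ := by
      by_contra hle
      exact hne (by simp [truncateEntries, not_lt.1 hle])
    apply hj
    rcases lt_trichotomy j k with h | h | h
    · refine Finset.mem_union_left _ (Finset.mem_image.2 ⟨⟨(j, k), h⟩, ?_, rfl⟩)
      simpa [hs] using hbig
    · subst h
      rw [hdiag, norm_zero] at hbig
      exact absurd hbig hτ.le.not_gt
    · refine Finset.mem_union_right _ (Finset.mem_image.2 ⟨⟨(k, j), h⟩, ?_, rfl⟩)
      have hsym : ‖A k j‖ = ‖A j k‖ := by rw [← hA.apply k j, norm_star]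
      simpa [hs, hsym] using hbig
  · calc _ ≤ (s.image (fun p => p.1.1)).card + (s.image (fun p => p.1.2)).card :=
          Finset.card_union_le _ _
      _ ≤ s.card + s.card := add_le_add Finset.card_image_le Finset.card_image_le
      _ = 2 * s.card := by ring

/-! ### Exponential moments of the exceedance count -/

/-- Chernoff bound for the number of exceedances of a level by independent random variables. -/
theorem measureReal_le_card_exceedances_le {Ω ι : Type*} [MeasurableSpace Ω] [Fintype ι]
    {P : Measure Ω} [IsProbabilityMeasure P] {X : ι → Ω → ℝ} (hX : ∀ i, Measurable (X i))
    (hind : iIndepFun X P) {τ p : ℝ} (hp : ∀ i, P.real {ω | τ < X i ω} ≤ p) (a : ℝ) :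
    P.real {ω | a ≤ ((Finset.univ.filter fun i => τ < X i ω).card : ℝ)} ≤
      Real.exp (-a + Fintype.card ι * p * (Real.exp 1 - 1)) := by
  classical
  let g : ℝ → ℝ := (Set.Ioi τ).indicator 1
  have hg : Measurable g := measurable_one.indicator measurableSet_Ioi
  have hset : ∀ i, MeasurableSet {ω | τ < X i ω} := fun i => measurableSet_lt measurable_const (hX i)
  let Y : ι → Ω → ℝ := fun i => g ∘ X i
  have hY : ∀ i, Measurable (Y i) := fun i => hg.comp (hX i)
  have hYval : ∀ i ω, Y i ω = if τ < X i ω then 1 else 0 := fun i ω => by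
    simp [Y, g, Set.indicator_apply]
  have hcard : ∀ ω, ((Finset.univ.filter fun i => τ < X i ω).card : ℝ) = (∑ i, Y i) ω := by
    intro ω
    simp [Finset.sum_apply, hYval]
  -- The exponential of an indicator is affine in it, so the moment generating function at `1` is
  -- explicit.
  have hexp : ∀ i ω, Real.exp (1 * Y i ω) =
      1 + {ω | τ < X i ω}.indicator (fun _ => Real.exp 1 - 1) ω := by
    intro i ω
    rw [hYval, Set.indicator_apply]
    by_cases h : τ < X i ω <;> simp [h]
  have he : 0 ≤ Real.exp 1 - 1 := by linarith [Real.add_one_le_exp (1 : ℝ)]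
  have hmgf : ∀ i, mgf (Y i) P 1 ≤ Real.exp (p * (Real.exp 1 - 1)) := by
    intro i
    have h1 : mgf (Y i) P 1 = 1 + P.real {ω | τ < X i ω} * (Real.exp 1 - 1) := by
      simp only [mgf, hexp]
      rw [integral_add (integrable_const _) ((integrable_const _).indicator (hset i)),
        integral_indicator_const _ (hset i)]
      simp
    rw [h1]
    have := Real.add_one_le_exp (p * (Real.exp 1 - 1))
    have := mul_le_mul_of_nonneg_right (hp i) he
    linarith
  have hbound : ∀ ω, (∑ i, Y i) ω ≤ Fintype.card ι := fun ω => by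
    rw [← hcard ω]
    exact_mod_cast Finset.card_le_univ _
  have hmeas : Measurable (∑ i, Y i) := by
    simpa only [Finset.sum_fn] using Finset.measurable_sum _ fun i _ => hY i
  have hint : Integrable (fun ω => Real.exp (1 * (∑ i, Y i) ω)) P := by
    refine Integrable.of_bound (C := Real.exp (Fintype.card ι))
      (by fun_prop) (Eventually.of_forall fun ω => ?_)
    rw [Real.norm_eq_abs, Real.abs_exp, one_mul]
    exact Real.exp_le_exp.2 (hbound ω)
  simp only [hcard]
  refine (measure_ge_le_exp_mul_mgf a zero_le_one hint).trans ?_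
  rw [(hind.comp (fun _ => g) fun _ => hg).mgf_sum hY, Real.exp_add]
  have hprod : ∏ i, mgf (Y i) P 1 ≤ Real.exp (Fintype.card ι * p * (Real.exp 1 - 1)) := by
    calc ∏ i, mgf (Y i) P 1 ≤ ∏ _i : ι, Real.exp (p * (Real.exp 1 - 1)) :=
          Finset.prod_le_prod (fun i _ => mgf_nonneg) fun i _ => hmgf i
      _ = _ := by
        rw [Finset.prod_const, ← Real.exp_nat_mul, Finset.card_univ, mul_assoc]
  rw [show -(1 : ℝ) * a = -a by ring]
  exact mul_le_mul_of_nonneg_left hprod (Real.exp_nonneg _)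

/-! ### Symmetrization by random signs -/

theorem measurePreserving_neg_rademacher :
    MeasurePreserving (fun x : ℝ => -x) rademacher rademacher := by
  refine ⟨measurable_neg, ?_⟩
  rw [rademacher, Measure.map_add _ _ measurable_neg, Measure.map_smul, Measure.map_smul,
    Measure.map_dirac' measurable_neg, Measure.map_dirac' measurable_neg, neg_neg, add_comm]

theorem ae_abs_eq_one_rademacher : ∀ᵐ x ∂rademacher, |x| = 1 := by
  rw [rademacher, ae_add_measure_iff]
  constructor <;> refine Measure.ae_smul_measure ?_ _ <;> simp [ae_dirac_eq]

/-- A Rademacher sum exceeds each of its coefficients in modulus with probability at least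
one half. -/
theorem inv_two_le_measure_lt_abs_rademacher_sum {ι : Type*} [Fintype ι] (a : ι → ℝ) {τ : ℝ}
    {i : ι} (hi : τ < |a i|) :
    (2⁻¹ : ℝ≥0∞) ≤ Measure.pi (fun _ : ι => rademacher) {s | τ < |∑ k, s k * a k|} := by
  classical
  set μ := Measure.pi (fun _ : ι => rademacher) with hμ
  set S := {s : ι → ℝ | τ < |∑ k, s k * a k|} with hS
  have hSm : MeasurableSet S := measurableSet_lt measurable_const (by fun_prop)
  -- `F` flips the sign at `i` and preserves the law. It moves the sum by `2 * |a i| > 2 * τ`, so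
  -- the two sums cannot both lie in `[-τ, τ]`.
  let F : (ι → ℝ) → ι → ℝ := fun s k => if k = i then -s k else s k
  have hF : MeasurePreserving F μ μ := by
    refine measurePreserving_pi (fun _ : ι => rademacher) (fun _ => rademacher)
      (f := fun k x => if k = i then -x else x) fun k => ?_
    by_cases hk : k = i
    · simpa [hk] using measurePreserving_neg_rademacher
    · simp only [hk, if_false]
      exact MeasurePreserving.id rademacher
  have hone : ∀ᵐ s ∂μ, |s i| = 1 :=
    (measurePreserving_eval (fun _ : ι => rademacher) i).quasiMeasurePreserving.ae
      ae_abs_eq_one_rademacher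
  have hcov : ∀ᵐ s ∂μ, s ∈ S ∪ F ⁻¹' S := by
    filter_upwards [hone] with s hs
    by_contra hcon
    simp only [Set.mem_union, Set.mem_preimage, hS, Set.mem_ofPred_eq, not_or, not_lt] at hcon
    obtain ⟨h1, h2⟩ := hcon
    have hF2 : ∑ k, F s k * a k = ∑ k, s k * a k - 2 * (s i * a i) := by
      have : ∀ k, F s k * a k = s k * a k - if k = i then 2 * (s k * a k) else 0 := fun k => by
        by_cases hk : k = i <;> simp [F, hk]
        ring
      simp [this, Finset.sum_sub_distrib]
    rw [hF2] at h2
    have hsa : |s i * a i| = |a i| := by rw [abs_mul, hs, one_mul]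
    rw [← hsa] at hi
    rw [abs_le] at h1 h2
    rcases lt_abs.1 hi with h | h <;> linarith
  have hle : (1 : ℝ≥0∞) ≤ 2 * μ S := by
    calc (1 : ℝ≥0∞) = μ (S ∪ F ⁻¹' S) := ((mem_ae_iff_prob_eq_one
          (hSm.union (hF.measurable hSm))).1 hcov).symm
      _ ≤ μ S + μ (F ⁻¹' S) := measure_union_le _ _
      _ = 2 * μ S := by rw [hF.measure_preimage hSm.nullMeasurableSet, two_mul]
  rw [ENNReal.inv_le_iff_le_mul (by simp) (by simp)]
  exact hle

/-- Lévy's inequality: a randomly signed sum is at least as large as each of its terms, up to a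
factor two in probability. -/
theorem measure_exists_lt_norm_le {Ω : Type*} [MeasurableSpace Ω] {P : Measure Ω}
    [IsProbabilityMeasure P] {n : ℕ} {A : Ω → Matrix (Fin n) (Fin n) ℂ}
    (hA : ∀ j k, Measurable fun ω => A ω j k) (j : Fin n) (τ : ℝ) :
    P {ω | ∃ k, τ < ‖A ω j k‖} ≤
      2 * (P.prod (Measure.pi fun _ : Fin n => rademacher)) {p | τ < |signedRowSum A j p|} := by
  set μ := Measure.pi (fun _ : Fin n => rademacher)
  have hE : MeasurableSet {ω | ∃ k, τ < ‖A ω j k‖} := by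
    rw [Set.ofPred_exists]
    exact MeasurableSet.iUnion fun k => measurableSet_lt measurable_const (hA j k).norm
  have hsum : Measurable (signedRowSum A j) := by
    unfold signedRowSum
    refine Finset.measurable_sum _ fun k _ => ?_
    exact ((measurable_pi_apply k).comp measurable_snd).mul ((hA j k).norm.comp measurable_fst)
  have hS : MeasurableSet {p | τ < |signedRowSum A j p|} :=
    measurableSet_lt measurable_const hsum.abs
  rw [Measure.prod_apply hS, ← ENNReal.inv_mul_le_iff (by simp) (by simp),
    ← lintegral_indicator_const hE]
  refine lintegral_mono fun ω => ?_
  rw [Set.indicator_apply]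
  split_ifs with hω
  · obtain ⟨k, hk⟩ := hω
    exact inv_two_le_measure_lt_abs_rademacher_sum (fun k => ‖A ω j k‖) (i := k) (by simpa using hk)
  · exact zero_le

/-- If independent events of equal probability rarely occur, the expected number of occurrences is
small. -/
theorem nat_mul_measureReal_le_of_measure_exists_le {Ω : Type*} [MeasurableSpace Ω] {P : Measure Ω}
    [IsProbabilityMeasure P] {n : ℕ} {X : Fin n → Ω → ℝ} (hX : ∀ i, Measurable (X i))
    (hind : iIndepFun X P) {τ q η : ℝ} (hq : ∀ i, P.real {ω | τ < X i ω} = q)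
    (h : P.real {ω | ∃ i, τ < X i ω} ≤ 1 - Real.exp (-η)) : n * q ≤ η := by
  have hset : ∀ i, MeasurableSet {ω | τ < X i ω} := fun i => measurableSet_lt measurable_const (hX i)
  have hE : MeasurableSet {ω | ∃ i, τ < X i ω} := by
    rw [Set.ofPred_exists]
    exact MeasurableSet.iUnion hset
  have hcompl : {ω | ∃ i, τ < X i ω}ᶜ = ⋂ i, X i ⁻¹' Set.Iic τ := by
    ext ω
    simp
  have hprod : P.real {ω | ∃ i, τ < X i ω}ᶜ = ∏ i, P.real (X i ⁻¹' Set.Iic τ) := by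
    rw [hcompl, measureReal_def, hind.meas_iInter fun i => ⟨_, measurableSet_Iic, rfl⟩,
      ENNReal.toReal_prod]
    rfl
  have hone : ∀ i, P.real (X i ⁻¹' Set.Iic τ) = 1 - q := fun i => by
    rw [← hq i, ← probReal_compl_eq_one_sub (hset i)]
    congr 1
    ext ω
    simp
  simp only [hone, Finset.prod_const, Finset.card_univ, Fintype.card_fin] at hprod
  rw [probReal_compl_eq_one_sub hE] at hprod
  rcases Nat.eq_zero_or_pos n with rfl | hn
  · have : Real.exp (-η) ≤ 1 := by
      have := measureReal_nonneg (μ := P) (s := {ω | ∃ i, τ < X i ω})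
      linarith
    simpa using this
  · have hq1 : 0 ≤ 1 - q := by
      rw [← hone ⟨0, hn⟩]
      exact measureReal_nonneg
    -- The probability of no exceedance is `(1 - q) ^ n`; it lies between `exp (-η)` and `exp (-(n *
    -- q))`.
    have hle : (1 - q) ^ n ≤ Real.exp (-(n * q)) := by
      calc (1 - q) ^ n ≤ Real.exp (-q) ^ n :=
            pow_le_pow_left₀ hq1 (Real.one_sub_le_exp_neg q) n
        _ = Real.exp (-(n * q)) := by rw [← Real.exp_nat_mul]; ring_nf
    have := Real.exp_le_exp.1 (show Real.exp (-η) ≤ Real.exp (-(n * q)) by linarith)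
    linarith

/-! ### Tightness of the signed row sums -/

theorem tendsto_measure_le_abs_atTop (μ : Measure ℝ) [IsFiniteMeasure μ] :
    Tendsto (fun τ : ℝ => μ {x | τ ≤ |x|}) atTop (𝓝 0) := by
  have h := tendsto_measure_iInter_atTop (μ := μ) (s := fun τ : ℝ => {x : ℝ | τ ≤ |x|})
    (fun τ => (measurableSet_le measurable_const measurable_norm).nullMeasurableSet)
    (fun a b hab x hx => le_trans hab hx) ⟨0, measure_ne_top _ _⟩
  have hempty : (⋂ τ : ℝ, {x : ℝ | τ ≤ |x|}) = ∅ := by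
    ext x
    simp only [Set.mem_iInter, Set.mem_ofPred_eq, Set.mem_empty_iff_false, iff_false, not_forall,
      not_le]
    exact ⟨|x| + 1, by linarith⟩
  rwa [hempty, measure_empty] at h

/-- Sequences converging in distribution have uniformly small tails, eventually. -/
theorem MeasureTheory.TendstoInDistribution.exists_eventually_measure_lt_abs_lt {Ω' : Type*}
    [MeasurableSpace Ω'] {Ω : ℕ → Type*} [∀ n, MeasurableSpace (Ω n)] {X : (n : ℕ) → Ω n → ℝ}
    {Z : Ω' → ℝ} {μ : (n : ℕ) → Measure (Ω n)} [∀ n, IsProbabilityMeasure (μ n)] {ν : Measure Ω'}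
    [IsProbabilityMeasure ν] (h : TendstoInDistribution X atTop Z μ ν) {c : ℝ≥0∞} (hc : 0 < c) :
    ∃ τ₀ : ℝ, ∀ᶠ n in atTop, μ n {ω | τ₀ < |X n ω|} < c := by
  have hprob : IsProbabilityMeasure (ν.map Z) :=
    Measure.isProbabilityMeasure_map h.aemeasurable_limit
  obtain ⟨τ₀, hτ₀⟩ := ((tendsto_measure_le_abs_atTop (ν.map Z)).eventually_lt_const hc).exists
  refine ⟨τ₀, ?_⟩
  -- The non-strict inequality gives a closed set, as the limsup half of the portmanteau theorem
  -- requires.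
  have hclosed : IsClosed {x : ℝ | τ₀ ≤ |x|} := isClosed_le continuous_const continuous_abs
  have hlim := ProbabilityMeasure.limsup_measure_closed_le_of_tendsto h.tendsto hclosed
  filter_upwards [eventually_lt_of_limsup_lt (hlim.trans_lt hτ₀)] with n hn
  refine lt_of_le_of_lt ?_ hn
  change _ ≤ (μ n).map (X n) _
  rw [Measure.map_apply_of_aemeasurable (h.forall_aemeasurable n) hclosed.measurableSet]
  exact measure_mono fun ω (hω : τ₀ < |X n ω|) => hω.le

/-! ### Exceedance probabilities of the ensemble -/

section Ensemble

variable {Ω : Type*} [MeasurableSpace Ω] {P : Measure Ω} [IsProbabilityMeasure P]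
  {C : (n : ℕ) → Ω → Matrix (Fin n) (Fin n) ℂ} {sigmaSq : ℝ} {Pi : Measure ℝ}

theorem IsLevyKhintchineEnsemble.measureReal_lt_norm_eq
    (hC : IsLevyKhintchineEnsemble P C sigmaSq Pi) {n : ℕ} {j k j' k' : Fin n} (h : j ≠ k)
    (h' : j' ≠ k') (τ : ℝ) :
    P.real {ω | τ < ‖C n ω j k‖} = P.real {ω | τ < ‖C n ω j' k'‖} :=
  congrArg ENNReal.toReal
    ((hC.identDistrib n j k j' k' h h').measure_mem_eq (measurableSet_Ioi (a := τ)))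

/-- The expected number of entries of a row exceeding a high level is small, for large matrices. -/
theorem IsLevyKhintchineEnsemble.exists_eventually_nat_mul_measureReal_le
    (hC : IsLevyKhintchineEnsemble P C sigmaSq Pi) {η : ℝ} (hη : 0 < η) :
    ∃ τ₀ : ℝ, ∀ᶠ n : ℕ in atTop, ∀ j k : Fin (n + 1), j ≠ k →
      n * P.real {ω | τ₀ < ‖C (n + 1) ω j k‖} ≤ η := by
  obtain ⟨μ, hμ, -, hlim⟩ := hC.limit
  have hpos : 0 < 1 - Real.exp (-η) := by
    have : Real.exp (-η) < 1 := by simpa using hη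
    linarith
  -- The half compensates for the factor two in Lévy's inequality.
  obtain ⟨τ₀, hτ₀⟩ := hlim.exists_eventually_measure_lt_abs_lt
    (c := ENNReal.ofReal ((1 - Real.exp (-η)) / 2)) (by simpa using hpos)
  refine ⟨τ₀, hτ₀.mono fun n hn j k hjk => ?_⟩
  have hrow := measure_exists_lt_norm_le (hC.measurable (n + 1)) 0 τ₀ (P := P)
  have hrow' : P {ω | ∃ k : Fin (n + 1), τ₀ < ‖C (n + 1) ω 0 k‖} ≤
      ENNReal.ofReal (1 - Real.exp (-η)) := by
    refine hrow.trans ((mul_le_mul_right hn.le 2).trans_eq ?_)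
    rw [← ENNReal.ofReal_ofNat, ← ENNReal.ofReal_mul (by norm_num)]
    congr 1
    ring
  -- Row `0` lies above the diagonal apart from its diagonal entry, so its other `n` moduli are
  -- independent.
  let e : Fin n → {p : Fin (n + 1) × Fin (n + 1) // p.1 < p.2} :=
    fun i => ⟨(0, i.succ), i.succ_pos⟩
  have he : Function.Injective e := fun i i' hii => by
    simpa [e] using hii
  refine nat_mul_measureReal_le_of_measure_exists_le (P := P)
    (X := fun i ω => ‖C (n + 1) ω 0 i.succ‖) (fun i => (hC.measurable _ _ _).norm)
    ((hC.indep (n + 1)).precomp he)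
    (fun i => hC.measureReal_lt_norm_eq (Fin.succ_ne_zero i).symm hjk τ₀) ?_
  refine (measureReal_mono ?_).trans (ENNReal.toReal_le_of_le_ofReal hpos.le hrow')
  rintro ω ⟨i, hi⟩
  exact ⟨i.succ, hi⟩

/-- Tightness only controls large `n`. The finitely many remaining sizes involve finitely many
entries, so raising the level handles them, and monotonicity in the level covers every larger `τ`.
-/
theorem IsLevyKhintchineEnsemble.exists_forall_nat_mul_measureReal_le
    (hC : IsLevyKhintchineEnsemble P C sigmaSq Pi) {η : ℝ} (hη : 0 < η) :
    ∃ τ₀ : ℝ, 0 < τ₀ ∧ ∀ τ, τ₀ ≤ τ → ∀ (n : ℕ) (j k : Fin (n + 1)), j ≠ k →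
      n * P.real {ω | τ < ‖C (n + 1) ω j k‖} ≤ η := by
  have hmono : ∀ {τ τ' : ℝ} (n : ℕ) (j k : Fin (n + 1)), τ ≤ τ' →
      n * P.real {ω | τ' < ‖C (n + 1) ω j k‖} ≤ n * P.real {ω | τ < ‖C (n + 1) ω j k‖} :=
    fun n j k h => mul_le_mul_of_nonneg_left
      (measureReal_mono fun ω (hω : _ < _) => h.trans_lt hω) n.cast_nonneg
  obtain ⟨τ₁, hτ₁⟩ := hC.exists_eventually_nat_mul_measureReal_le hη
  obtain ⟨N, hN⟩ := eventually_atTop.1 hτ₁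
  have hsmall : ∀ (n : ℕ) (j k : Fin (n + 1)), ∀ᶠ τ : ℝ in atTop,
      n * P.real {ω | τ < ‖C (n + 1) ω j k‖} ≤ η := by
    intro n j k
    have hm : Measurable fun ω => ‖C (n + 1) ω j k‖ := (hC.measurable _ _ _).norm
    have ht := (ENNReal.tendsto_toReal ENNReal.zero_ne_top).comp
      (tendsto_measure_le_abs_atTop (P.map fun ω => ‖C (n + 1) ω j k‖))
    have ht' := ht.const_mul (n : ℝ)
    simp only [ENNReal.toReal_zero, mul_zero] at ht'
    filter_upwards [ht'.eventually_lt_const hη] with τ hτ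
    refine le_trans (mul_le_mul_of_nonneg_left ?_ n.cast_nonneg) hτ.le
    have hmap : P.map (fun ω => ‖C (n + 1) ω j k‖) {x | τ ≤ |x|} =
        P {ω | τ ≤ |‖C (n + 1) ω j k‖|} :=
      Measure.map_apply hm (measurableSet_le measurable_const measurable_norm)
    rw [Function.comp_apply, hmap]
    exact measureReal_mono fun ω (hω : τ < ‖C (n + 1) ω j k‖) => hω.le.trans (le_abs_self _)
  have hfin : ∀ᶠ τ : ℝ in atTop, ∀ n ∈ Finset.range N, ∀ j k : Fin (n + 1),
      n * P.real {ω | τ < ‖C (n + 1) ω j k‖} ≤ η :=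
    (Finset.eventually_all _).2 fun n _ => eventually_all.2 fun j => eventually_all.2 (hsmall n j)
  obtain ⟨τ₀, hfin₀, hτ₁₀, hpos⟩ :=
    (hfin.and ((eventually_ge_atTop τ₁).and (eventually_gt_atTop 0))).exists
  refine ⟨τ₀, hpos, fun τ hτ n j k hjk => ?_⟩
  rcases lt_or_ge n N with h | h
  · exact (hmono n j k hτ).trans (hfin₀ n (Finset.mem_range.2 h) j k)
  · exact (hmono n j k (hτ₁₀.trans hτ)).trans (hN n h j k hjk)

end Ensemble

theorem card_fin_lt_pairs_le (n : ℕ) :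
    Fintype.card {p : Fin (n + 1) × Fin (n + 1) // p.1 < p.2} ≤ (n + 1) * n := by
  classical
  rw [Fintype.card_subtype]
  calc _ ≤ (Finset.univ : Finset (Fin (n + 1))).offDiag.card :=
        Finset.card_le_card fun p hp => by
          simpa using ne_of_lt (Finset.mem_filter.1 hp).2
    _ = (n + 1) * n := by
        rw [Finset.offDiag_card, Finset.card_univ, Fintype.card_fin, ← Nat.mul_sub_one]
        rfl

theorem mainTheorem11 {Ω : Type*} [MeasurableSpace Ω] (P : Measure Ω) [IsProbabilityMeasure P]
    (C : (n : ℕ) → Ω → Matrix (Fin n) (Fin n) ℂ) (sigmaSq : ℝ) (Pi : Measure ℝ)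
    (hC : IsLevyKhintchineEnsemble P C sigmaSq Pi) (ε : ℝ) (hε : 0 < ε) :
    ∃ τ₀ : ℝ, 0 < τ₀ ∧ ∀ τ : ℝ, τ₀ ≤ τ → ∃ δ : ℝ, 0 < δ ∧ ∀ n : ℕ, 1 ≤ n →
      P.real {ω | ε ≤ ((C n ω - truncateEntries τ (C n ω)).rank : ℝ) / n} ≤ Real.exp (-δ * n) := by
  obtain ⟨τ₀, hτ₀, h⟩ := hC.exists_forall_nat_mul_measureReal_le (η := ε / 8) (by positivity)
  -- For matrix size `N` the Chernoff exponent is at most `-ε N / 2 + 2 (ε / 8) N = -ε N / 4`, using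
  -- `exp 1 - 1 ≤ 2`.
  refine ⟨τ₀, hτ₀, fun τ hτ => ⟨ε / 4, by positivity, fun n hn => ?_⟩⟩
  obtain ⟨n, rfl⟩ := Nat.exists_eq_add_of_le' hn
  have hn0 : (0 : ℝ) < (n + 1 : ℕ) := by positivity
  have hsub : {ω | ε ≤ ((C (n + 1) ω - truncateEntries τ (C (n + 1) ω)).rank : ℝ) / (n + 1 : ℕ)} ⊆
      {ω | ε * (n + 1 : ℕ) / 2 ≤
        ((Finset.univ.filter fun p : {p : Fin (n + 1) × Fin (n + 1) // p.1 < p.2} =>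
          τ < ‖C (n + 1) ω p.1.1 p.1.2‖).card : ℝ)} := by
    intro ω hω
    have h1 := (le_div_iff₀ hn0).1 hω
    have h2 : ((C (n + 1) ω - truncateEntries τ (C (n + 1) ω)).rank : ℝ) ≤ _ :=
      Nat.cast_le.2 (rank_sub_truncateEntries_le (hτ₀.trans_le hτ) (hC.isHermitian _ ω)
        (hC.diag_eq_zero _ ω))
    push_cast at h1 h2
    simp only [Set.mem_ofPred_eq]
    push_cast
    linarith
  refine (measureReal_mono hsub).trans ?_
  have he : 0 ≤ Real.exp 1 - 1 := by linarith [Real.add_one_le_exp (1 : ℝ)]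
  have he2 : Real.exp 1 - 1 ≤ 2 := by linarith [Real.exp_one_lt_three]
  -- A matrix of size one has no entry above the diagonal, so the event is empty; the general case
  -- divides by `n`.
  rcases Nat.eq_zero_or_pos n with rfl | hnpos
  · have hempty : IsEmpty {p : Fin (0 + 1) × Fin (0 + 1) // p.1 < p.2} :=
      ⟨fun p => by omega⟩
    have h0 : ¬ ε * (0 + 1 : ℕ) / 2 ≤ 0 := by simpa using hε
    simp only [Finset.univ_eq_empty, Finset.filter_empty, Finset.card_empty, Nat.cast_zero, h0,
      Set.ofPred_false, measureReal_empty]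
    positivity
  have hn' : (0 : ℝ) < n := by exact_mod_cast hnpos
  refine (measureReal_le_card_exceedances_le (P := P)
    (X := fun (p : {p : Fin (n + 1) × Fin (n + 1) // p.1 < p.2}) ω => ‖C (n + 1) ω p.1.1 p.1.2‖)
    (fun p => (hC.measurable _ _ _).norm) (hC.indep (n + 1)) (τ := τ) (p := ε / 8 / n)
    (fun p => by
      rw [le_div_iff₀ hn', mul_comm]
      exact h τ hτ n _ _ p.2.ne) _).trans ?_
  refine Real.exp_le_exp.2 ?_
  have hcard : (Fintype.card {p : Fin (n + 1) × Fin (n + 1) // p.1 < p.2} : ℝ) * (ε / 8 / n) ≤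
      (n + 1 : ℕ) * (ε / 8) := by
    calc _ ≤ (((n + 1) * n : ℕ) : ℝ) * (ε / 8 / n) :=
          mul_le_mul_of_nonneg_right (Nat.cast_le.2 (card_fin_lt_pairs_le n)) (by positivity)
      _ = _ := by
        push_cast
        field_simp
  have hmul := mul_le_mul hcard he2 he (by positivity)
  linarith
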